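/- Let \(S\) be a locally compact Hausdorff space with countable base, let \(\Omega\) be the space of càdlàg functions \(\mathbb{R}_+\to S\) with coordinate process \(X_t(\omega)=\omega(t)\), \(\mathcal F=\sigma(X_t,\,t\ge 0)\) and \(\mathcal F_t=\bigcap_{s>t}\sigma(X_r,\,r\le s)\), and let \(\theta_t\omega(s)=\omega(t+s)\). Let \(D\subseteq C(S)\) be a set of continuous functions \(S\to\mathbb{R}\) and let \(\mathcal L\) map each \(f\in D\) to a Borel function \(\mathcal Lf\colon S\to\mathbb{R}\) such that \(\int_0^t|\mathcal Lf(X_s(\omega))|\,ds<\infty\) for all \(t\ge 0\), \(\omega\in\Omega\), \(f\in D\). Let \(\Sigma\in\mathcal F\). A probability measure \(P\) on \((\Omega,\mathcal F)\) solves the martingale problem \((D,\mathcal L,\Sigma,x)\) if \(P(\Sigma)=1\), \(P\circ X_0^{-1}=\delta_x\) and, for every \(f\in D\), the process \(f(X_t)-f(X_0)-\int_0^t\mathcal Lf(X_s)\,ds\), \(t\ge 0\), is a local \(P\)-martingale for \((\mathcal F_t)_{t\ge 0}\). For every \(x\in S\) let \(P_x\) be a solution to the martingale problem \((D,\mathcal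 L,\Sigma,x)\), and set \(T_tf(x)=E_x[f(X_t)]\). The family \((P_x)_{x\in S}\) is Markov if \(x\mapsto P_x(A)\) is Borel for all \(A\in\mathcal F\) and \(P_x(\theta_t^{-1}G\mid\mathcal F_t)=P_{X_t}(G)\) \(P_x\)-a.s. for all \(x\in S\), \(t\ge 0\), \(G\in\mathcal F\). It is \(C_b\)-Feller if it is Markov and \(T_t(C_b(S))\subseteq C_b(S)\) for all \(t\ge 0\). It is Feller-Dynkin if it is \(C_b\)-Feller and \(T_t(C_0(S))\subseteq C_0(S)\) for all \(t\ge 0\), where \(C_0(S)\) is the space of continuous functions vanishing at infinity. An extension of \((D,\mathcal L)\) is a pair \((D',\mathcal L')\) such that \(D\subseteq D'\subseteq C(S)\), \(\mathcal L'\) maps \(D'\) to the Borel functions on \(S\), \(\mathcal L'=\mathcal L\) on \(D\), \(\int_0^t|\mathcal L'f(X_s(\omega))|\,ds<\infty\) for all \(t\ge 0\), \(\omega\in\Omega\), \(f\in D'\), and \(P_x\) solves the martingale problem \((D',\mathcal L',\Sigma,x)\) for every \(x\in S\). Theorem. Suppose that \(\mathcal Lf\in C_0(S)\) for all \(f\in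 D\cap C_0(S)\) and that \((P_x)_{x\in S}\) is \(C_b\)-Feller. Then the following are equivalent: (i) \((P_x)_{x\in S}\) is Feller-Dynkin. (ii) There is an extension \((D',\mathcal L')\) of \((D,\mathcal L)\) such that for every compact set \(K\subseteq S\) there exists a function \(V\colon S\to\mathbb{R}_+\) with \(V\in D'\cap C_0(S)\), \(\min_{x\in K}V(x)>0\) (no condition if \(K=\emptyset\)), and \(\mathcal L'V\le cV\) for a constant \(c>0\). -/

import Mathlib

open MeasureTheory ProbabilityTheory Filter Topology
open scoped NNReal ENNReal BoundedContinuousFunction ZeroAtInfty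

namespace MartingaleProblem

/-- A path `ω : ℝ₊ → S` is càdlàg: right-continuous on `[0, ∞)` with left limits in `S` on
`(0, ∞)`. -/
def IsCadlag {S : Type*} [TopologicalSpace S] (ω : ℝ≥0 → S) : Prop :=
  (∀ t, ContinuousWithinAt ω (Set.Ici t) t) ∧
    ∀ t, 0 < t → ∃ l : S, Tendsto ω (𝓝[<] t) (𝓝 l)

/-- The path space `Ω` of all càdlàg functions `ℝ₊ → S`. Its σ-field is the one that the subtype
inherits from the product σ-field, that is, the σ-field `σ(X_t, t ∈ ℝ₊)` generated by the
coordinates. -/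
abbrev PathSpace (S : Type*) [TopologicalSpace S] : Type _ :=
  {ω : ℝ≥0 → S // IsCadlag ω}

/-- The coordinate process `X_t(ω) = ω(t)`. -/
def coord {S : Type*} [TopologicalSpace S] (t : ℝ≥0) (ω : PathSpace S) : S := ω.1 t

theorem measurable_coord {S : Type*} [TopologicalSpace S] [MeasurableSpace S] (t : ℝ≥0) :
    Measurable (coord t : PathSpace S → S) :=
  (measurable_pi_apply t).comp measurable_subtype_coe

theorem IsCadlag.shift {S : Type*} [TopologicalSpace S] {ω : ℝ≥0 → S} (h : IsCadlag ω)
    (t : ℝ≥0) : IsCadlag (fun s => ω (t + s)) := by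
  refine ⟨fun s => ?_, fun s hs => ?_⟩
  · refine (h.1 (t + s)).comp (Continuous.continuousWithinAt (by fun_prop)) ?_
    intro u hu
    exact add_le_add (le_refl t) hu
  · obtain ⟨l, hl⟩ := h.2 (t + s) (by positivity)
    refine ⟨l, hl.comp ?_⟩
    refine tendsto_nhdsWithin_of_tendsto_nhds_of_eventually_within _ ?_ ?_
    · exact ((by fun_prop : Continuous fun u : ℝ≥0 => t + u).tendsto s).mono_left
        nhdsWithin_le_nhds
    · filter_upwards [self_mem_nhdsWithin] with u hu
      exact (add_lt_add_iff_left t).2 hu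

/-- The shift operator `θ_t ω(s) = ω(t + s)`. -/
def shift {S : Type*} [TopologicalSpace S] (t : ℝ≥0) (ω : PathSpace S) : PathSpace S :=
  ⟨fun s => ω.1 (t + s), ω.2.shift t⟩

/-- The filtration `ℱᵒ_t = σ(X_s, s ≤ t)`. -/
def rawFiltration (S : Type*) [TopologicalSpace S] [mS : MeasurableSpace S] :
    Filtration ℝ≥0 (inferInstance : MeasurableSpace (PathSpace S)) where
  seq t := ⨆ s : ℝ≥0, ⨆ _ : s ≤ t, mS.comap (coord s)
  mono' _ _ hst := iSup₂_mono' fun u hu => ⟨u, hu.trans hst, le_rfl⟩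
  le' _ := iSup₂_le fun s _ => (measurable_coord s).comap_le

/-- The right-continuous filtration `ℱ_t = ⋂_{s > t} ℱᵒ_s`. -/
noncomputable def filtration (S : Type*) [TopologicalSpace S] [MeasurableSpace S] :
    Filtration ℝ≥0 (inferInstance : MeasurableSpace (PathSpace S)) :=
  (rawFiltration S).rightCont

/-- Local martingales for the filtration `(ℱ_t)`. -/
def IsLocalMartingale {S : Type*} [TopologicalSpace S] [MeasurableSpace S]
    (M : ℝ≥0 → PathSpace S → ℝ) (P : Measure (PathSpace S)) : Prop :=
  Locally (fun Y => Martingale Y (filtration S) P) (filtration S) M P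

/-- The input data `(D, 𝓛)` of a martingale problem: a set `D ⊆ C(S)` of test functions and a map
`𝓛` from `D` to the Borel functions on `S` such that `∫₀ᵗ |𝓛 f(X_s(ω))| ds < ∞` for all
`t`, `ω` and `f ∈ D`. -/
structure InputData (S : Type*) [TopologicalSpace S] [MeasurableSpace S] where
  /-- The set of test functions. -/
  D : Set C(S, ℝ)
  /-- The operator. -/
  L : D → S → ℝ
  measurable_L : ∀ f : D, Measurable (L f)
  integrable_L : ∀ (f : D) (ω : PathSpace S) (t : ℝ≥0),
    IntervalIntegrable (fun s : ℝ => L f (coord s.toNNReal ω)) volume 0 t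

/-- The process `f(X_t) - f(X_0) - ∫₀ᵗ 𝓛 f(X_s) ds` of a test function `f ∈ D`. -/
noncomputable def InputData.process {S : Type*} [TopologicalSpace S] [MeasurableSpace S]
    (d : InputData S) (f : d.D) (t : ℝ≥0) (ω : PathSpace S) : ℝ :=
  f.1 (coord t ω) - f.1 (coord 0 ω) - ∫ s in (0 : ℝ)..t, d.L f (coord s.toNNReal ω)

/-- `P` is a solution to the martingale problem `(D, 𝓛, Γ, η)`, where `Γ ⊆ Ω` is the state space
for the paths and `η` is the initial law. -/
structure InputData.IsSolution {S : Type*} [TopologicalSpace S] [MeasurableSpace S]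
    (d : InputData S) (Γ : Set (PathSpace S)) (η : Measure S) (P : Measure (PathSpace S)) :
    Prop where
  isProbabilityMeasure : IsProbabilityMeasure P
  measure_eq_one : P Γ = 1
  initial_law : P.map (coord 0) = η
  isLocalMartingale : ∀ f : d.D, IsLocalMartingale (d.process f) P

/-- `(P_x)` is a Markov family: `x ↦ P_x(A)` is Borel for all `A ∈ ℱ`, and
`P_x(θ_t⁻¹ G | ℱ_t) = P_{X_t}(G)` holds `P_x`-almost surely for all `x`, `t` and `G ∈ ℱ`. -/
structure IsMarkovFamily {S : Type*} [TopologicalSpace S] [MeasurableSpace S]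
    (P : S → Measure (PathSpace S)) : Prop where
  measurable : ∀ A : Set (PathSpace S), MeasurableSet A → Measurable fun x => P x A
  markov : ∀ (x : S) (t : ℝ≥0) (G : Set (PathSpace S)), MeasurableSet G →
    (P x)[(shift t ⁻¹' G).indicator (fun _ => (1 : ℝ)) | filtration S t]
      =ᵐ[P x] fun ω => (P (coord t ω)).real G

/-- The operators `T_t f(x) = E_x[f(X_t)]`. -/
noncomputable def semigroup {S : Type*} [TopologicalSpace S] [MeasurableSpace S]
    (P : S → Measure (PathSpace S)) (t : ℝ≥0) (f : S → ℝ) (x : S) : ℝ :=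
  ∫ ω, f (coord t ω) ∂(P x)

/-- `(P_x)` is `C_b`-Feller: it is Markov and `T_t(C_b(S)) ⊆ C_b(S)` for all `t`. -/
structure IsCbFeller {S : Type*} [TopologicalSpace S] [MeasurableSpace S]
    (P : S → Measure (PathSpace S)) : Prop where
  isMarkov : IsMarkovFamily P
  map_Cb : ∀ (t : ℝ≥0) (f : S →ᵇ ℝ), ∃ g : S →ᵇ ℝ, ⇑g = semigroup P t f

/-- `(P_x)` is Feller-Dynkin: it is `C_b`-Feller and `T_t(C_0(S)) ⊆ C_0(S)` for all `t`. -/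
structure IsFellerDynkin {S : Type*} [TopologicalSpace S] [MeasurableSpace S]
    (P : S → Measure (PathSpace S)) : Prop where
  isCbFeller : IsCbFeller P
  map_C0 : ∀ (t : ℝ≥0) (f : C₀(S, ℝ)), ∃ g : C₀(S, ℝ), ⇑g = semigroup P t f

/-- `V` is a Lyapunov function for the set `K`: `V ≥ 0`, `V ∈ D ∩ C_0(S)`, `V` is bounded below
by a positive constant on `K` (for compact `K ≠ ∅`: `min_K V > 0`), and `𝓛 V ≤ c V` for some
constant `c > 0`. -/
structure InputData.IsLyapunov {S : Type*} [TopologicalSpace S] [MeasurableSpace S]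
    (d : InputData S) (K : Set S) (V : d.D) : Prop where
  nonneg : ∀ x, 0 ≤ V.1 x
  mem_C0 : ∃ g : C₀(S, ℝ), ⇑g = ⇑V.1
  pos : ∃ m : ℝ, 0 < m ∧ ∀ x ∈ K, m ≤ V.1 x
  le : ∃ c : ℝ, 0 < c ∧ ∀ x, d.L V x ≤ c * V.1 x

/-- `(D', 𝓛')` is an extension of `(D, 𝓛)` for the family `(P_x)` of solutions with path state
space `Γ`: `D ⊆ D'`, `𝓛' = 𝓛` on `D`, and every `P_x` solves the martingale problem
`(D', 𝓛', Γ, x)`. -/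
structure InputData.IsExtension {S : Type*} [TopologicalSpace S] [MeasurableSpace S]
    (d' d : InputData S) (Γ : Set (PathSpace S)) (P : S → Measure (PathSpace S)) : Prop where
  subset : d.D ⊆ d'.D
  eq_on : ∀ f : d.D, d'.L ⟨f.1, subset f.2⟩ = d.L f
  isSolution : ∀ x : S, d'.IsSolution Γ (Measure.dirac x) (P x)

end MartingaleProblem

/-! From Feller-Dynkin to Lyapunov functions: let `R g = ∫₀^∞ e⁻ˢ T_s g ds` be the 1-resolvent. If
each `T_s` preserves `C₀`, so does `R`, by dominated convergence
(`IsFellerDynkin.exists_resolvent_eq`). The resolvent equation and the Markov property make `R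
g(X_t) - R g(X_0) - ∫₀ᵗ (R g - g)(X_s) ds` a martingale under every `P_x` (`martingale_resolvent`),
so the functions `R g` with `0 ≤ g ∈ C₀` can be adjoined to `D` with `𝓛'(R g) = R g - g ≤ R g`. If
`g = 1` on `K`, then `R g > 0` on `K`. A function `R g` that already lies in `D` has a prescribed
image `𝓛(R g)`; this image is in `C₀` by hypothesis, and comparing derivatives of `T_u (R g)` at `u
= 0` forces it to be `R g - g`.

From Lyapunov functions to Feller-Dynkin: localization, Fatou's lemma and Grönwall's inequality turn
`𝓛'V ≤ cV` into `T_t V ≤ e^{ct} V` (`InputData.IsSolution.semigroup_le_exp_mul`). Each `f ∈ C₀`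
satisfies `|f| ≤ ε/2 + const · V` when `V` belongs to a compact set off which `|f| < ε/2`. Hence
`|T_t f| ≤ ε/2 + const · e^{ct} V`, which is below `ε` near infinity; continuity of `T_t f` is the
`C_b`-Feller property. -/

namespace MartingaleProblem

/-! ### Calculus of right-continuous functions: measurability, primitives, Laplace transform,
Grönwall. -/

section RightContinuous

/-- A right-continuous process is jointly measurable. -/
theorem measurable_uncurry_of_continuousWithinAt_Ici {Ω E : Type*} [MeasurableSpace Ω]
    [TopologicalSpace E] [TopologicalSpace.PseudoMetrizableSpace E] [MeasurableSpace E]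
    [BorelSpace E] {Y : ℝ → Ω → E} (hY : ∀ s, Measurable (Y s))
    (hr : ∀ ω s, ContinuousWithinAt (fun u => Y u ω) (Set.Ici s) s) :
    Measurable fun p : ℝ × Ω => Y p.1 p.2 := by
  -- Time is discretized to the next grid point strictly to the right, at distance at most
  -- `1/(n+1)`, so right-continuity gives convergence; each approximation depends on time only
  -- through an integer.
  refine measurable_of_tendsto_metrizable
    (f := fun (n : ℕ) p => Y ((⌊((n : ℝ) + 1) * p.1⌋ + 1) / ((n : ℝ) + 1)) p.2)
    (fun n => ?_) (tendsto_pi_nhds.2 fun p => ?_)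
  · have h : Measurable fun q : ℤ × Ω => Y ((q.1 + 1) / ((n : ℝ) + 1)) q.2 :=
      measurable_from_prod_countable_right fun k => hY ((k + 1) / ((n : ℝ) + 1))
    exact h.comp
      ((Int.measurable_floor.comp (measurable_fst.const_mul ((n : ℝ) + 1))).prodMk measurable_snd)
  · refine (hr p.2 p.1).tendsto.comp (tendsto_nhdsWithin_iff.2 ⟨?_, .of_forall fun n => ?_⟩)
    · have h : Tendsto (fun n : ℕ => p.1 + 1 / ((n : ℝ) + 1)) atTop (𝓝 p.1) := by
        simpa using tendsto_const_nhds.add (tendsto_one_div_add_atTop_nhds_zero_nat (𝕜 := ℝ))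
      refine tendsto_of_tendsto_of_tendsto_of_le_of_le tendsto_const_nhds h (fun n => ?_)
        fun n => ?_
      · have hn : (0 : ℝ) < (n : ℝ) + 1 := by positivity
        simp only [le_div_iff₀ hn]
        nlinarith [Int.lt_floor_add_one (((n : ℝ) + 1) * p.1)]
      · have hn : (0 : ℝ) < (n : ℝ) + 1 := by positivity
        simp only [div_le_iff₀ hn, add_mul p.1, one_div, inv_mul_cancel₀ hn.ne']
        linarith [Int.floor_le (((n : ℝ) + 1) * p.1)]
    · have hn : (0 : ℝ) < (n : ℝ) + 1 := by positivity
      simp only [Set.mem_Ici, le_div_iff₀ hn]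
      nlinarith [Int.lt_floor_add_one (((n : ℝ) + 1) * p.1)]

theorem measurable_of_continuousWithinAt_Ici {γ : ℝ → ℝ}
    (hr : ∀ s, ContinuousWithinAt γ (Set.Ici s) s) : Measurable γ := by
  have h : Measurable fun p : ℝ × Unit => γ p.1 :=
    measurable_uncurry_of_continuousWithinAt_Ici (Y := fun s _ => γ s)
      (fun s => measurable_const) fun _ s => hr s
  exact h.comp (measurable_id.prodMk (measurable_const (a := ())))

theorem intervalIntegrable_of_measurable_of_bound {γ : ℝ → ℝ} (hm : Measurable γ) {C : ℝ}
    (hC : ∀ s, |γ s| ≤ C) (a b : ℝ) : IntervalIntegrable γ volume a b :=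
  (intervalIntegrable_const (c := C)).mono_fun' hm.aestronglyMeasurable (.of_forall hC)

theorem hasDerivWithinAt_integral_Ici {γ : ℝ → ℝ}
    (hr : ∀ s, ContinuousWithinAt γ (Set.Ici s) s) {C : ℝ} (hC : ∀ s, |γ s| ≤ C) (u : ℝ) :
    HasDerivWithinAt (fun u => ∫ s in (0 : ℝ)..u, γ s) (γ u) (Set.Ici u) u := by
  have hm := measurable_of_continuousWithinAt_Ici hr
  exact intervalIntegral.integral_hasDerivWithinAt_right
    (intervalIntegrable_of_measurable_of_bound hm hC 0 u) (t := Set.Ioi u)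
    hm.stronglyMeasurable.stronglyMeasurableAtFilter ((hr u).mono Set.Ioi_subset_Ici_self)

theorem continuous_integral_of_bound {γ : ℝ → ℝ} (hm : Measurable γ) {C : ℝ}
    (hC : ∀ s, |γ s| ≤ C) : Continuous fun u => ∫ s in (0 : ℝ)..u, γ s :=
  intervalIntegral.continuous_primitive (intervalIntegrable_of_measurable_of_bound hm hC) 0

/-- Bounded right-continuous functions whose primitives agree on the half-line agree at `0`. -/
theorem eq_of_integral_eq {γ δ : ℝ → ℝ}
    (hγ : ∀ s, ContinuousWithinAt γ (Set.Ici s) s) {C : ℝ} (hC : ∀ s, |γ s| ≤ C)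
    (hδ : ∀ s, ContinuousWithinAt δ (Set.Ici s) s) {C' : ℝ} (hC' : ∀ s, |δ s| ≤ C')
    (h : ∀ u, 0 ≤ u → ∫ s in (0 : ℝ)..u, γ s = ∫ s in (0 : ℝ)..u, δ s) : γ 0 = δ 0 := by
  have h1 := hasDerivWithinAt_integral_Ici hγ hC 0
  have h2 := hasDerivWithinAt_integral_Ici hδ hC' 0
  exact (uniqueDiffOn_Ici (0 : ℝ) 0 Set.self_mem_Ici).eq_deriv _ h1
    (h2.congr (fun u hu => h u hu) (h 0 le_rfl))

theorem integrableOn_exp_neg (a : ℝ) : IntegrableOn (fun s : ℝ => Real.exp (-s)) (Set.Ioi a) := by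
  simpa using exp_neg_integrableOn_Ioi a one_pos

theorem integrableOn_exp_neg_mul {γ : ℝ → ℝ} (hm : Measurable γ) {C : ℝ} (hC : ∀ s, |γ s| ≤ C)
    (a : ℝ) : IntegrableOn (fun s : ℝ => Real.exp (-s) * γ s) (Set.Ioi a) :=
  (integrableOn_exp_neg a).mul_bdd hm.aestronglyMeasurable (.of_forall hC)

/-- The Laplace transform at `1` of the shifted function `γ(· + u)` solves `ψ' = ψ - γ` in
integrated form. -/
theorem integral_exp_neg_mul_shift {γ : ℝ → ℝ}
    (hr : ∀ s, ContinuousWithinAt γ (Set.Ici s) s) {C : ℝ} (hC : ∀ s, |γ s| ≤ C) (u : ℝ) :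
    (∫ s in Set.Ioi (0 : ℝ), Real.exp (-s) * γ (s + u))
        - ∫ s in Set.Ioi (0 : ℝ), Real.exp (-s) * γ s
      = ∫ r in (0 : ℝ)..u, ((∫ s in Set.Ioi (0 : ℝ), Real.exp (-s) * γ (s + r)) - γ r) := by
  have hm := measurable_of_continuousWithinAt_Ici hr
  have hint := integrableOn_exp_neg_mul hm hC
  -- Substituting `s + r` for `s` moves the dependence on `r` into a factor `e^r` and an integration
  -- limit, where it can be differentiated from the right.
  have key : ∀ r : ℝ, (∫ s in Set.Ioi (0 : ℝ), Real.exp (-s) * γ (s + r))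
      = Real.exp r * ((∫ s in Set.Ioi (0 : ℝ), Real.exp (-s) * γ s)
        - ∫ s in (0 : ℝ)..r, Real.exp (-s) * γ s) := by
    intro r
    rw [← intervalIntegral.integral_interval_add_Ioi (hint 0) (hint r), add_sub_cancel_left,
      ← integral_const_mul]
    have h := (measurePreserving_add_right (volume : Measure ℝ) r).setIntegral_preimage_emb
      (measurableEmbedding_addRight r)
      (fun s => Real.exp r * (Real.exp (-s) * γ s)) (Set.Ioi r)
    rw [← h]
    simp only [Set.preimage_add_const_Ioi, sub_self]
    refine integral_congr_ae (.of_forall fun s => ?_)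
    simp only
    rw [← mul_assoc, ← Real.exp_add]
    congr 2
    ring
  have hr' : ∀ s, ContinuousWithinAt (fun s => Real.exp (-s) * γ s) (Set.Ici s) s := fun s =>
    (by fun_prop : Continuous fun s : ℝ => Real.exp (-s)).continuousWithinAt.mul (hr s)
  have hii : ∀ a b : ℝ, IntervalIntegrable (fun s => Real.exp (-s) * γ s) volume a b := fun a b =>
    (intervalIntegrable_of_measurable_of_bound hm hC a b).continuousOn_mul (by fun_prop)
  have hderiv : ∀ r : ℝ, HasDerivWithinAt
      (fun r => ∫ s in Set.Ioi (0 : ℝ), Real.exp (-s) * γ (s + r))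
      ((∫ s in Set.Ioi (0 : ℝ), Real.exp (-s) * γ (s + r)) - γ r) (Set.Ioi r) r := by
    intro r
    have h1 : HasDerivWithinAt (fun r => ∫ s in (0 : ℝ)..r, Real.exp (-s) * γ s)
        (Real.exp (-r) * γ r) (Set.Ici r) r :=
      intervalIntegral.integral_hasDerivWithinAt_right (hii 0 r) (t := Set.Ioi r)
        (measurable_of_continuousWithinAt_Ici
          hr').stronglyMeasurable.stronglyMeasurableAtFilter
        ((hr' r).mono Set.Ioi_subset_Ici_self)
    simp only [key]
    have h2 := (Real.hasDerivAt_exp r).hasDerivWithinAt.mul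
      ((h1.mono Set.Ioi_subset_Ici_self).const_sub
        (∫ s in Set.Ioi (0 : ℝ), Real.exp (-s) * γ s))
    refine h2.congr_deriv ?_
    have : Real.exp r * Real.exp (-r) = 1 := by rw [← Real.exp_add]; simp
    linear_combination (-γ r) * this
  have hcont : Continuous fun r => ∫ s in Set.Ioi (0 : ℝ), Real.exp (-s) * γ (s + r) := by
    simp only [key]
    exact Real.continuous_exp.mul
      (continuous_const.sub (intervalIntegral.continuous_primitive hii 0))
  rw [intervalIntegral.integral_eq_sub_of_hasDeriv_right hcont.continuousOn
    (fun r _ => hderiv r)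
    ((hcont.intervalIntegrable 0 u).sub (intervalIntegrable_of_measurable_of_bound hm hC 0 u))]
  simp

/-- Grönwall's inequality in integral form for right-continuous functions. -/
theorem le_exp_mul_of_le_add_integral {φ : ℝ → ℝ}
    (hr : ∀ s, ContinuousWithinAt φ (Set.Ici s) s) {C : ℝ} (hC : ∀ s, |φ s| ≤ C) {a c : ℝ}
    (hc : 0 < c) (h : ∀ t, 0 ≤ t → φ t ≤ a + c * ∫ s in (0 : ℝ)..t, φ s) {t : ℝ} (ht : 0 ≤ t) :
    φ t ≤ a * Real.exp (c * t) := by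
  have hm := measurable_of_continuousWithinAt_Ici hr
  -- The differential Grönwall inequality is applied to the primitive of `φ`, whose right derivative
  -- is `φ`; its bound is then inserted into `h`.
  have hb := le_gronwallBound_of_liminf_deriv_right_le (f := fun u => ∫ s in (0 : ℝ)..u, φ s)
    (f' := φ) (δ := 0) (K := c) (ε := a) (a := 0) (b := t)
    (continuous_integral_of_bound hm hC).continuousOn
    (fun x _ r hxr => (hasDerivWithinAt_integral_Ici hr hC x).liminf_right_slope_le hxr)
    (by simp) (fun x hx => by linarith [h x hx.1]) t ⟨ht, le_rfl⟩
  rw [gronwallBound_of_K_ne_0 hc.ne'] at hb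
  simp only [zero_mul, zero_add, sub_zero] at hb
  calc φ t ≤ a + c * (a / c * (Real.exp (c * t) - 1)) := (h t ht).trans (by gcongr)
    _ = a * Real.exp (c * t) := by field_simp; ring

end RightContinuous

/-- The filter of complements of compact sets is countably generated on a σ-compact locally compact
space. -/
theorem isCountablyGenerated_cocompact (S : Type*) [TopologicalSpace S] [SigmaCompactSpace S]
    [WeaklyLocallyCompactSpace S] : (cocompact S).IsCountablyGenerated := by
  let K := CompactExhaustion.choice S
  refine HasCountableBasis.isCountablyGenerated (p := fun _ : ℕ => True) (s := fun n => (K n)ᶜ)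
    ⟨⟨fun s => ?_⟩, Set.to_countable _⟩
  rw [mem_cocompact]
  constructor
  · rintro ⟨t, ht, hts⟩
    obtain ⟨n, hn⟩ := K.exists_superset_of_isCompact ht
    exact ⟨n, trivial, (Set.compl_subset_compl.2 hn).trans hts⟩
  · rintro ⟨n, -, hn⟩
    exact ⟨K n, K.isCompact n, hn⟩

/-! ### The coordinate process, the Markov property and compensated processes. -/

section Coordinate

variable {S : Type*} [TopologicalSpace S]

/-- Through `Real.toNNReal` the path is frozen at `X_0` for negative times, so right-continuity
holds at every real time and real-variable calculus applies. -/
theorem continuousWithinAt_coord (ω : PathSpace S) (s : ℝ) :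
    ContinuousWithinAt (fun u : ℝ => coord u.toNNReal ω) (Set.Ici s) s :=
  ContinuousWithinAt.comp (t := Set.Ici s.toNNReal) (ω.2.1 s.toNNReal)
    continuous_real_toNNReal.continuousWithinAt fun _ hu => Real.toNNReal_le_toNNReal hu

/-- The process `f(X_t) - f(X_0) - ∫₀ᵗ h(X_s) ds`. -/
noncomputable def compensated (f h : S → ℝ) (t : ℝ≥0) (ω : PathSpace S) : ℝ :=
  f (coord t ω) - f (coord 0 ω) - ∫ s in (0 : ℝ)..t, h (coord s.toNNReal ω)

theorem abs_compensated_le {f h : S → ℝ} {C C' : ℝ} (hC : ∀ x, |f x| ≤ C)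
    (hC' : ∀ x, |h x| ≤ C') (t : ℝ≥0) (ω : PathSpace S) : |compensated f h t ω| ≤ 2 * C + C' * t := by
  have h1 := hC (coord t ω)
  have h2 := hC (coord 0 ω)
  have h3 : |∫ s in (0 : ℝ)..t, h (coord s.toNNReal ω)| ≤ C' * |(t : ℝ) - 0| := by
    rw [← Real.norm_eq_abs]
    exact intervalIntegral.norm_integral_le_of_norm_le_const fun s _ => hC' _
  rw [sub_zero, abs_of_nonneg t.coe_nonneg] at h3
  rw [abs_le] at *
  unfold compensated
  constructor <;> linarith [h1.1, h1.2, h2.1, h2.2, h3.1, h3.2]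

variable [MeasurableSpace S]

theorem measurable_shift (t : ℝ≥0) : Measurable (shift t : PathSpace S → PathSpace S) :=
  Measurable.subtype_mk (measurable_pi_lambda _ fun s => measurable_coord (t + s))

theorem measurable_coord_filtration {s t : ℝ≥0} (hst : s ≤ t) :
    Measurable[filtration S t] (coord s : PathSpace S → S) := by
  refine Measurable.mono (comap_measurable (coord s)) ?_ le_rfl
  exact le_trans (le_iSup₂_of_le (f := fun u (_ : u ≤ t) =>
    MeasurableSpace.comap (coord u : PathSpace S → S) inferInstance) s hst le_rfl)
    ((rawFiltration S).le_rightCont t)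

section Expectation

variable (μ : Measure (PathSpace S))

theorem integrable_comp_coord [IsFiniteMeasure μ] {h : S → ℝ} (hh : Measurable h) {C : ℝ}
    (hC : ∀ x, |h x| ≤ C) (t : ℝ≥0) : Integrable (fun ω => h (coord t ω)) μ :=
  Integrable.of_bound (hh.comp (measurable_coord t)).aestronglyMeasurable C
    (.of_forall fun _ => hC _)

theorem abs_integral_comp_coord_le [IsProbabilityMeasure μ] {h : S → ℝ} {C : ℝ}
    (hC : ∀ x, |h x| ≤ C) (t : ℝ≥0) : |∫ ω, h (coord t ω) ∂μ| ≤ C := by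
  simpa using norm_integral_le_of_norm_le_const (μ := μ) (f := fun ω => h (coord t ω))
    (.of_forall fun _ => hC _)

theorem continuousWithinAt_integral_coord [OpensMeasurableSpace S] [IsFiniteMeasure μ]
    {h : S → ℝ} (hh : Continuous h) {C : ℝ} (hC : ∀ x, |h x| ≤ C) (s : ℝ) :
    ContinuousWithinAt (fun u : ℝ => ∫ ω, h (coord u.toNNReal ω) ∂μ) (Set.Ici s) s :=
  continuousWithinAt_of_dominated (bound := fun _ => C)
    (.of_forall fun _ => (hh.measurable.comp (measurable_coord _)).aestronglyMeasurable)
    (.of_forall fun _ => .of_forall fun _ => hC _) (integrable_const C)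
    (.of_forall fun ω => hh.continuousAt.comp_continuousWithinAt (continuousWithinAt_coord ω s))

end Expectation

/-- The simple Markov property for bounded measurable functionals. -/
theorem IsMarkovFamily.setIntegral_shift {P : S → Measure (PathSpace S)}
    [∀ x, IsProbabilityMeasure (P x)] (hP : IsMarkovFamily P) (x : S) (t : ℝ≥0)
    {A : Set (PathSpace S)} (hA : MeasurableSet[filtration S t] A) {Φ : PathSpace S → ℝ}
    (hΦ : Measurable Φ) {C : ℝ} (hC : ∀ ω, |Φ ω| ≤ C) :
    ∫ ω in A, Φ (shift t ω) ∂P x = ∫ ω in A, ∫ η, Φ η ∂P (coord t ω) ∂P x := by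
  have hA' : MeasurableSet A := (filtration S).le t A hA
  let κ : Kernel (PathSpace S) (PathSpace S) :=
    ⟨fun ω => P (coord t ω), Measure.measurable_of_measurable_coe _ fun G hG =>
      (hP.measurable G hG).comp (measurable_coord t)⟩
  have : IsMarkovKernel κ := ⟨fun ω => inferInstanceAs (IsProbabilityMeasure (P (coord t ω)))⟩
  let ρ : Measure (PathSpace S) := (P x).restrict A
  -- The law of the shifted path on `A` is the mixture of the laws `P_{X_t}`. The Markov property
  -- gives this on events; as an identity of measures it passes to bounded functionals.
  have hmeas : ρ.map (shift t) = (κ ∘ₖ Kernel.const Unit ρ) () := by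
    ext G hG
    have hG' : MeasurableSet (shift t ⁻¹' G) := measurable_shift t hG
    rw [Measure.map_apply (measurable_shift t) hG, Kernel.comp_apply' _ _ _ hG, Kernel.const_apply]
    have hi : Integrable ((shift t ⁻¹' G).indicator fun _ => (1 : ℝ)) (P x) :=
      (integrable_const 1).indicator hG'
    have h1 := setIntegral_condExp ((filtration S).le t) hi hA
    rw [setIntegral_congr_ae hA' ((hP.markov x t G hG).mono fun _ h _ => h),
      integral_indicator hG', setIntegral_const, smul_eq_mul, mul_one] at h1
    have h2 : ∫⁻ ω, κ ω G ∂ρ = ENNReal.ofReal (∫ ω, (P (coord t ω)).real G ∂ρ) := by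
      rw [ofReal_integral_eq_lintegral_ofReal]
      · exact lintegral_congr fun ω => (ofReal_measureReal (measure_ne_top _ _)).symm
      · refine Integrable.of_bound (C := 1) (((hP.measurable G hG).comp
          (measurable_coord t)).ennreal_toReal).aestronglyMeasurable (.of_forall fun ω => ?_)
        rw [Real.norm_of_nonneg measureReal_nonneg]
        exact measureReal_le_one
      · exact .of_forall fun _ => measureReal_nonneg
    rw [h2, h1, ofReal_measureReal (measure_ne_top _ _)]
  calc ∫ ω in A, Φ (shift t ω) ∂P x = ∫ η, Φ η ∂(ρ.map (shift t)) :=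
        (integral_map (measurable_shift t).aemeasurable hΦ.aestronglyMeasurable).symm
    _ = ∫ ω, ∫ η, Φ η ∂κ ω ∂(Kernel.const Unit ρ ()) := by
        rw [hmeas, Kernel.integral_comp]
        rw [← hmeas]
        exact Integrable.of_bound hΦ.aestronglyMeasurable C (.of_forall hC)
    _ = _ := rfl

variable [T2Space S] [LocallyCompactSpace S] [SecondCountableTopology S] [BorelSpace S]

theorem measurable_uncurry_coord :
    Measurable fun p : ℝ × PathSpace S => coord p.1.toNNReal p.2 :=
  measurable_uncurry_of_continuousWithinAt_Ici (fun s => measurable_coord s.toNNReal)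
    continuousWithinAt_coord

theorem measurable_comp_coord {h : S → ℝ} (hh : Measurable h) (ω : PathSpace S) :
    Measurable fun s : ℝ => h (coord s.toNNReal ω) :=
  hh.comp (measurable_uncurry_coord.comp (measurable_id.prodMk measurable_const))

theorem intervalIntegrable_comp_coord {h : S → ℝ} (hh : Measurable h) {C : ℝ}
    (hC : ∀ x, |h x| ≤ C) (ω : PathSpace S) (a b : ℝ) :
    IntervalIntegrable (fun s : ℝ => h (coord s.toNNReal ω)) volume a b :=
  intervalIntegrable_of_measurable_of_bound (measurable_comp_coord hh ω) (fun _ => hC _) a b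

/-- Time integrals of the coordinate process are adapted. -/
theorem measurable_integral_coord {h : S → ℝ} (hh : Measurable h) (t : ℝ≥0) :
    Measurable[filtration S t]
      fun ω : PathSpace S => ∫ s in (0 : ℝ)..t, h (coord s.toNNReal ω) := by
  -- Progressive measurability: stopping the clock at `t` makes every coordinate `ℱ_t`-measurable
  -- and changes nothing on `(0, t]`.
  have h1 : Measurable[(inferInstance : MeasurableSpace ℝ).prod (filtration S t)]
      fun p : ℝ × PathSpace S => coord (min p.1.toNNReal t) p.2 := by
    refine @measurable_uncurry_of_continuousWithinAt_Ici (PathSpace S) S (filtration S t) _ _ _ _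
      (fun s ω => coord (min s.toNNReal t) ω)
      (fun s => measurable_coord_filtration (min_le_right _ _)) fun ω s => ?_
    refine ContinuousWithinAt.comp (t := Set.Ici (min s.toNNReal t)) (ω.2.1 _)
      (continuous_real_toNNReal.min continuous_const).continuousWithinAt fun u hu => ?_
    exact min_le_min_right t (Real.toNNReal_le_toNNReal hu)
  have h2 := (@StronglyMeasurable.integral_prod_left' ℝ (PathSpace S) ℝ _ (filtration S t)
    (volume.restrict (Set.Ioc (0 : ℝ) t)) _ _ _ _
    (@Measurable.stronglyMeasurable _ _ (_) _ _ _ _ _ _ (hh.comp h1))).measurable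
  convert! h2 using 1
  ext ω
  rw [intervalIntegral.integral_of_le t.coe_nonneg]
  refine setIntegral_congr_fun measurableSet_Ioc fun s hs => ?_
  simp only [Function.comp_apply]
  rw [min_eq_left (Real.toNNReal_le_iff_le_coe.2 hs.2)]

section Expectation

variable (μ : Measure (PathSpace S))

/-- Fubini's theorem for weighted time integrals of the coordinate process. -/
theorem integral_integral_coord [IsFiniteMeasure μ] {h : S → ℝ} (hh : Measurable h) {C : ℝ}
    (hC : ∀ x, |h x| ≤ C) {ν : Measure ℝ} [SFinite ν] {w : ℝ → ℝ} (hw : Integrable w ν) (u : ℝ) :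
    ∫ ω, ∫ s, w s * h (coord (s + u).toNNReal ω) ∂ν ∂μ
      = ∫ s, w s * ∫ ω, h (coord (s + u).toNNReal ω) ∂μ ∂ν := by
  rw [integral_integral_swap]
  · simp only [integral_const_mul]
  · refine (hw.comp_snd μ).mul_bdd (c := C) (Measurable.aestronglyMeasurable ?_)
      (.of_forall fun p => hC _)
    exact hh.comp (measurable_uncurry_coord.comp
      ((measurable_snd.add_const u).prodMk measurable_fst))

theorem integral_intervalIntegral_coord [IsFiniteMeasure μ] {h : S → ℝ} (hh : Measurable h)
    {C : ℝ} (hC : ∀ x, |h x| ≤ C) (t : ℝ≥0) :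
    ∫ ω, (∫ s in (0 : ℝ)..t, h (coord s.toNNReal ω)) ∂μ
      = ∫ s in (0 : ℝ)..t, ∫ ω, h (coord s.toNNReal ω) ∂μ := by
  simp only [intervalIntegral.integral_of_le t.coe_nonneg]
  simpa using integral_integral_coord μ hh hC (ν := volume.restrict (Set.Ioc (0 : ℝ) t))
    (w := fun _ => 1) (integrable_const 1) 0

end Expectation

section Compensated

variable {f h : S → ℝ}

theorem measurable_compensated (hf : Measurable f) (hh : Measurable h) (t : ℝ≥0) :
    Measurable[filtration S t] (compensated f h t) := by
  have hs : ∀ s ≤ t, Measurable[filtration S t] fun ω : PathSpace S => f (coord s ω) :=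
    fun s hst => hf.comp (measurable_coord_filtration hst)
  exact ((hs t le_rfl).sub (hs 0 zero_le)).sub (measurable_integral_coord hh t)

/-- Additivity in time: the increment after `t` is the same functional of the restarted path, the
form to which the Markov property applies. -/
theorem compensated_shift (hh : Measurable h) {C : ℝ} (hC : ∀ x, |h x| ≤ C) (t u : ℝ≥0)
    (ω : PathSpace S) :
    compensated f h u (shift t ω) = compensated f h (t + u) ω - compensated f h t ω := by
  have hI := intervalIntegrable_comp_coord hh hC ω
  have h1 : ∫ s in (0 : ℝ)..u, h (coord s.toNNReal (shift t ω))
      = ∫ s in (t : ℝ)..(t + u : ℝ≥0), h (coord s.toNNReal ω) := by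
    have h2 := intervalIntegral.integral_comp_add_right (a := 0) (b := (u : ℝ))
      (fun s => h (coord s.toNNReal ω)) (t : ℝ)
    rw [zero_add, add_comm (u : ℝ), ← NNReal.coe_add] at h2
    rw [← h2]
    refine intervalIntegral.integral_congr fun s hs => ?_
    rw [Set.uIcc_of_le u.coe_nonneg] at hs
    have h3 : (s + t).toNNReal = t + s.toNNReal := by
      rw [Real.toNNReal_add hs.1 t.coe_nonneg, Real.toNNReal_coe, add_comm]
    simp only [h3]
    rfl
  have h4 := intervalIntegral.integral_add_adjacent_intervals (hI 0 t) (hI t (t + u : ℝ≥0))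
  have h5 : coord u (shift t ω) = coord (t + u) ω := rfl
  have h6 : coord 0 (shift t ω) = coord t ω := by simp [coord, shift]
  simp only [compensated, h1, h5, h6, ← h4]
  ring

theorem integral_compensated (μ : Measure (PathSpace S)) [IsProbabilityMeasure μ] {x : S}
    (hx : μ.map (coord 0) = Measure.dirac x) (hf : Measurable f) {C : ℝ} (hC : ∀ x, |f x| ≤ C)
    (hh : Measurable h) {C' : ℝ} (hC' : ∀ x, |h x| ≤ C') (t : ℝ≥0) :
    ∫ ω, compensated f h t ω ∂μ
      = (∫ ω, f (coord t ω) ∂μ) - f x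
        - ∫ s in (0 : ℝ)..t, ∫ ω, h (coord s.toNNReal ω) ∂μ := by
  have h0 : ∫ ω, f (coord 0 ω) ∂μ = f x := by
    rw [← integral_map (f := f) (measurable_coord 0).aemeasurable
      hf.aestronglyMeasurable, hx, integral_dirac]
  have hi : Integrable (fun ω => ∫ s in (0 : ℝ)..t, h (coord s.toNNReal ω)) μ := by
    refine Integrable.of_bound (((measurable_integral_coord hh t).mono ((filtration S).le t)
      le_rfl).aestronglyMeasurable) (C' * |(t : ℝ) - 0|) (.of_forall fun ω => ?_)
    exact intervalIntegral.norm_integral_le_of_norm_le_const fun s _ => hC' _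
  have hi' : Integrable (fun ω => f (coord t ω) - f (coord 0 ω)) μ :=
    (integrable_comp_coord μ hf hC t).sub (integrable_comp_coord μ hf hC 0)
  unfold compensated
  rw [integral_sub hi' hi,
    integral_sub (integrable_comp_coord μ hf hC t) (integrable_comp_coord μ hf hC 0), h0,
    integral_intervalIntegral_coord μ hh hC']

end Compensated

section Markov

variable {P : S → Measure (PathSpace S)} [∀ x, IsProbabilityMeasure (P x)]

/-- If all `P_x`-expectations of a compensated process vanish, then it is a martingale. -/
theorem IsMarkovFamily.martingale_compensated (hP : IsMarkovFamily P) {f h : S → ℝ}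
    (hf : Measurable f) {C : ℝ} (hC : ∀ x, |f x| ≤ C) (hh : Measurable h) {C' : ℝ}
    (hC' : ∀ x, |h x| ≤ C') (h0 : ∀ x t, ∫ ω, compensated f h t ω ∂P x = 0) (x : S) :
    Martingale (compensated f h) (filtration S) (P x) := by
  have hm := measurable_compensated hf hh
  have hm' : ∀ t, Measurable (compensated f h t) := fun t =>
    (hm t).mono ((filtration S).le t) le_rfl
  have hi : ∀ t, Integrable (compensated f h t) (P x) := fun t =>
    Integrable.of_bound (hm' t).aestronglyMeasurable _ (.of_forall (abs_compensated_le hC hC' t))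
  refine ⟨fun t => (hm t).stronglyMeasurable, fun i j hij => ?_⟩
  refine (ae_eq_condExp_of_forall_setIntegral_eq ((filtration S).le i) (hi j)
    (fun A _ _ => (hi i).integrableOn) (fun A hA _ => ?_)
    (hm i).stronglyMeasurable.aestronglyMeasurable).symm
  -- Given `ℱ_i`, the increment from `i` to `j` has conditional mean `E_{X_i}` of the process at
  -- time `j - i`, which is `0` by `h0`.
  have h1 := hP.setIntegral_shift x i hA (hm' (j - i)) (abs_compensated_le hC hC' (j - i))
  simp only [h0, compensated_shift hh hC', integral_zero, add_tsub_cancel_of_le hij] at h1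
  rw [integral_sub (hi j).integrableOn (hi i).integrableOn] at h1
  linarith

end Markov

end Coordinate

/-! ### Expectations of local martingales. -/

section LocalMartingale

variable {S : Type*} [TopologicalSpace S] [MeasurableSpace S] {M : ℝ≥0 → PathSpace S → ℝ}
  {Q : Measure (PathSpace S)} [IsProbabilityMeasure Q]

/-- A local martingale started at `0` has mean zero along a sequence of bounded random times
that are eventually equal to a given time. -/
theorem IsLocalMartingale.exists_integral_eq_zero (hM : IsLocalMartingale M Q)
    (h0 : ∀ ω, M 0 ω = 0) (t : ℝ≥0) :
    ∃ σ : ℕ → PathSpace S → ℝ≥0, (∀ n ω, σ n ω ≤ t) ∧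
      (∀ᵐ ω ∂Q, ∀ᶠ n in atTop, σ n ω = t) ∧
      ∀ n, Integrable (fun ω => M (σ n ω) ω) Q ∧ ∫ ω, M (σ n ω) ω ∂Q = 0 := by
  obtain ⟨τ, hτ, hm⟩ := hM
  -- The minimum with a finite time is never `⊤`, so the default value of `untopA` plays no role.
  have hcoe : ∀ (s : ℝ≥0) n ω, ((min (s : WithTop ℝ≥0) (τ n ω)).untopA : WithTop ℝ≥0)
      = min (s : WithTop ℝ≥0) (τ n ω) := fun s n ω => by
    rw [WithTop.untopA_eq_untop (ne_top_of_le_ne_top WithTop.coe_ne_top (min_le_left _ _)),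
      WithTop.coe_untop]
  have hle : ∀ (s : ℝ≥0) n ω, (min (s : WithTop ℝ≥0) (τ n ω)).untopA ≤ s := fun s n ω =>
    WithTop.coe_le_coe.1 ((hcoe s n ω).trans_le (min_le_left _ _))
  -- The indicator in the definition of localization is harmless: where `τ n = 0`, the stopped
  -- process is `M 0 = 0` anyway.
  have hpath : ∀ n s, stoppedProcess (fun i => {ω | ⊥ < τ n ω}.indicator (M i)) (τ n) s
      = fun ω => M (min (s : WithTop ℝ≥0) (τ n ω)).untopA ω := by
    intro n s
    ext ω
    by_cases h : ⊥ < τ n ω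
    · simp only [stoppedProcess]
      exact Set.indicator_of_mem (s := {ω | ⊥ < τ n ω}) h _
    · have hz : (min (s : WithTop ℝ≥0) (τ n ω)).untopA = 0 := by
        have h1 := hcoe s n ω
        rw [not_bot_lt_iff.1 h, min_bot_right] at h1
        rw [not_bot_lt_iff.1 h, min_bot_right]
        exact WithTop.coe_injective h1
      simp only [stoppedProcess, hz, h0]
      exact Set.indicator_of_notMem (s := {ω | ⊥ < τ n ω}) h _
  refine ⟨fun n ω => (min (t : WithTop ℝ≥0) (τ n ω)).untopA, hle t, ?_, fun n => ?_⟩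
  · filter_upwards [hτ.tendsto_top] with ω hω
    filter_upwards [hω.eventually (lt_mem_nhds (WithTop.coe_lt_top t))] with n hn
    exact WithTop.coe_injective ((hcoe t n ω).trans (min_eq_left hn.le))
  · have h1 := (hm n).integrable t
    have h2 := (hm n).setIntegral_eq (zero_le : 0 ≤ t) MeasurableSet.univ
    rw [hpath] at h1
    rw [hpath, hpath] at h2
    refine ⟨h1, ?_⟩
    have h3 : ∀ ω, (min ((0 : ℝ≥0) : WithTop ℝ≥0) (τ n ω)).untopA = 0 := fun ω =>
      le_antisymm (hle 0 n ω) zero_le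
    simpa [h3, h0] using h2.symm

/-- A local martingale started at `0` that is bounded on `[0, t]` has mean zero at time `t`. -/
theorem IsLocalMartingale.integral_eq_zero (hM : IsLocalMartingale M Q)
    (h0 : ∀ ω, M 0 ω = 0) (t : ℝ≥0) {C : ℝ} (hC : ∀ s ≤ t, ∀ ω, |M s ω| ≤ C) :
    ∫ ω, M t ω ∂Q = 0 := by
  obtain ⟨σ, hσt, hσ, hint⟩ := hM.exists_integral_eq_zero h0 t
  have h := tendsto_integral_of_dominated_convergence (μ := Q)
    (F := fun n ω => M (σ n ω) ω) (f := M t) (fun _ => C)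
    (fun n => (hint n).1.aestronglyMeasurable) (integrable_const C)
    (fun n => .of_forall fun ω => hC _ (hσt n ω) ω)
    (hσ.mono fun ω hω => tendsto_const_nhds.congr' (hω.mono fun n hn => by simp only [hn]))
  simp only [(hint _).2] at h
  exact tendsto_nhds_unique h tendsto_const_nhds

end LocalMartingale

theorem compensated_zero {S : Type*} [TopologicalSpace S] (f h : S → ℝ) (ω : PathSpace S) :
    compensated f h 0 ω = 0 := by
  simp [compensated]

theorem abs_apply_le_norm {S : Type*} [TopologicalSpace S] (g : C₀(S, ℝ)) (x : S) : |g x| ≤ ‖g‖ := by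
  rw [← ZeroAtInftyContinuousMap.norm_toBCF_eq_norm]
  exact g.toBCF.norm_coe_le_norm x

/-! ### The operators `T_t`. -/

section Semigroup

theorem semigroup_zero {S : Type*} [TopologicalSpace S] [T2Space S] [SecondCountableTopology S]
    [MeasurableSpace S] [BorelSpace S] {P : S → Measure (PathSpace S)} {x : S}
    (hx : (P x).map (coord 0) = Measure.dirac x) {h : S → ℝ}
    (hh : Measurable h) : semigroup P 0 h x = h x := by
  rw [semigroup, ← integral_map (f := h) (measurable_coord 0).aemeasurable
    hh.aestronglyMeasurable, hx, integral_dirac]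

variable {S : Type*} [TopologicalSpace S] [MeasurableSpace S] {P : S → Measure (PathSpace S)}
  [∀ x, IsProbabilityMeasure (P x)]

theorem continuousWithinAt_semigroup [OpensMeasurableSpace S] (x : S) {h : S → ℝ} (hh : Continuous h) {C : ℝ}
    (hC : ∀ x, |h x| ≤ C) (s : ℝ) :
    ContinuousWithinAt (fun u : ℝ => semigroup P u.toNNReal h x) (Set.Ici s) s :=
  continuousWithinAt_integral_coord (P x) hh hC s

theorem abs_semigroup_le {h : S → ℝ} {C : ℝ} (hC : ∀ x, |h x| ≤ C) (t : ℝ≥0) (x : S) :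
    |semigroup P t h x| ≤ C :=
  abs_integral_comp_coord_le (P x) hC t

/-- A bounded continuous function is determined by the integrals of the semigroup along it. -/
theorem eq_of_integral_semigroup_eq [T2Space S] [SecondCountableTopology S] [BorelSpace S]
    {x : S} (hx : (P x).map (coord 0) = Measure.dirac x) {h h' : S → ℝ}
    (hh : Continuous h) {C : ℝ} (hC : ∀ x, |h x| ≤ C) (hh' : Continuous h')
    {C' : ℝ} (hC' : ∀ x, |h' x| ≤ C')
    (heq : ∀ u : ℝ≥0, ∫ s in (0 : ℝ)..u, semigroup P s.toNNReal h x
      = ∫ s in (0 : ℝ)..u, semigroup P s.toNNReal h' x) : h x = h' x := by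
  have := eq_of_integral_eq (continuousWithinAt_semigroup (P := P) x hh hC)
    (fun s => abs_semigroup_le hC _ x) (continuousWithinAt_semigroup (P := P) x hh' hC')
    (fun s => abs_semigroup_le hC' _ x) (fun u hu => heq ⟨u, hu⟩)
  simpa [semigroup_zero hx hh.measurable, semigroup_zero hx hh'.measurable] using this

end Semigroup

/-! ### The resolvent and its martingales. -/

/-- The functional `∫₀^∞ e⁻ˢ g(X_s) ds`. -/
noncomputable def laplace {S : Type*} [TopologicalSpace S] (g : S → ℝ)
    (ω : PathSpace S) : ℝ :=
  ∫ s in Set.Ioi (0 : ℝ), Real.exp (-s) * g (coord s.toNNReal ω)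

/-- The resolvent at `1`, that is, `∫₀^∞ e⁻ˢ T_s g ds`. -/
noncomputable def resolvent {S : Type*} [TopologicalSpace S] [MeasurableSpace S]
    (P : S → Measure (PathSpace S)) (g : S → ℝ) (x : S) : ℝ :=
  ∫ s in Set.Ioi (0 : ℝ), Real.exp (-s) * semigroup P s.toNNReal g x

theorem abs_integral_exp_neg_mul_le {γ : ℝ → ℝ} {C : ℝ} (hC : ∀ s, |γ s| ≤ C) :
    |∫ s in Set.Ioi (0 : ℝ), Real.exp (-s) * γ s| ≤ C := by
  have h := norm_integral_le_of_norm_le (μ := volume.restrict (Set.Ioi (0 : ℝ)))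
    (f := fun s => Real.exp (-s) * γ s) (g := fun s => Real.exp (-s) * C)
    ((integrableOn_exp_neg 0).mul_const C) (.of_forall fun s => by
      rw [norm_mul, Real.norm_of_nonneg (Real.exp_pos _).le]
      exact mul_le_mul_of_nonneg_left (hC s) (Real.exp_pos _).le)
  rwa [integral_mul_const, integral_exp_neg_Ioi_zero, one_mul] at h

theorem resolvent_nonneg {S : Type*} [TopologicalSpace S] [MeasurableSpace S]
    {P : S → Measure (PathSpace S)} {g : S → ℝ} (hg : ∀ x, 0 ≤ g x) (x : S) : 0 ≤ resolvent P g x :=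
  integral_nonneg fun _ => mul_nonneg (Real.exp_pos _).le (integral_nonneg fun _ => hg _)

theorem abs_resolvent_le {S : Type*} [TopologicalSpace S] [MeasurableSpace S]
    {P : S → Measure (PathSpace S)} [∀ x, IsProbabilityMeasure (P x)] {g : S → ℝ} {C : ℝ}
    (hC : ∀ x, |g x| ≤ C) (x : S) : |resolvent P g x| ≤ C :=
  abs_integral_exp_neg_mul_le fun _ => abs_semigroup_le hC _ x

/-- As `T_0 g(x) = g(x) > 0`, right-continuity keeps `T_s g(x)` positive on some `[0, δ)`, and the
integrand is nonnegative elsewhere. -/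
theorem resolvent_pos {S : Type*} [TopologicalSpace S] [T2Space S] [SecondCountableTopology S]
    [MeasurableSpace S] [BorelSpace S] {P : S → Measure (PathSpace S)}
    [∀ x, IsProbabilityMeasure (P x)] {g : S → ℝ} (hg : Continuous g) {C : ℝ}
    (hC : ∀ x, |g x| ≤ C) (hg0 : ∀ x, 0 ≤ g x) {x : S}
    (hx : (P x).map (coord 0) = Measure.dirac x) (hgx : 0 < g x) :
    0 < resolvent P g x := by
  have hr := continuousWithinAt_semigroup (P := P) x hg hC
  have hT : ∀ s : ℝ, 0 ≤ semigroup P s.toNNReal g x := fun s => integral_nonneg fun _ => hg0 _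
  rw [resolvent, setIntegral_pos_iff_support_of_nonneg_ae
    (.of_forall fun s => mul_nonneg (Real.exp_pos _).le (hT s))
    (integrableOn_exp_neg_mul (measurable_of_continuousWithinAt_Ici hr)
      (fun s => abs_semigroup_le hC _ x) 0)]
  have h1 : ∀ᶠ s in 𝓝[≥] (0 : ℝ), 0 < semigroup P s.toNNReal g x :=
    (hr 0).eventually (lt_mem_nhds (by simpa [semigroup_zero hx hg.measurable] using hgx))
  obtain ⟨δ, hδ, hsub⟩ := mem_nhdsGE_iff_exists_Ico_subset.1 h1
  refine lt_of_lt_of_le ?_ (measure_mono (s := Set.Ioo 0 δ) fun s hs => ⟨?_, hs.1⟩)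
  · simpa using hδ
  · exact (mul_pos (Real.exp_pos _) (hsub ⟨hs.1.le, hs.2⟩)).ne'

variable {S : Type*} [TopologicalSpace S] [T2Space S] [LocallyCompactSpace S]
  [SecondCountableTopology S] [MeasurableSpace S] [BorelSpace S]

section Resolvent

theorem measurable_laplace {g : S → ℝ} (hg : Measurable g) : Measurable (laplace g) := by
  have h : Measurable fun p : ℝ × PathSpace S => Real.exp (-p.1) * g (coord p.1.toNNReal p.2) :=
    (by fun_prop : Measurable fun p : ℝ × PathSpace S => Real.exp (-p.1)).mul
      (hg.comp measurable_uncurry_coord)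
  exact (h.stronglyMeasurable.integral_prod_left'
    (μ := volume.restrict (Set.Ioi (0 : ℝ)))).measurable

variable {P : S → Measure (PathSpace S)} [∀ x, IsProbabilityMeasure (P x)] {g : S → ℝ}

theorem integral_laplace_shift (hg : Measurable g) {C : ℝ} (hC : ∀ x, |g x| ≤ C) (u : ℝ≥0)
    (x : S) : ∫ ω, laplace g (shift u ω) ∂P x
      = ∫ s in Set.Ioi (0 : ℝ), Real.exp (-s) * semigroup P (s + u).toNNReal g x := by
  refine Eq.trans ?_ (integral_integral_coord (P x) hg hC (integrableOn_exp_neg 0) u)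
  refine integral_congr_ae (.of_forall fun ω => ?_)
  refine setIntegral_congr_fun measurableSet_Ioi fun s hs => ?_
  have h : (s + u).toNNReal = u + s.toNNReal := by
    rw [Real.toNNReal_add (le_of_lt hs) u.coe_nonneg, Real.toNNReal_coe, add_comm]
  simp only [h]
  rfl

theorem integral_laplace (hg : Measurable g) {C : ℝ} (hC : ∀ x, |g x| ≤ C) (x : S) :
    ∫ ω, laplace g ω ∂P x = resolvent P g x := by
  have h := integral_integral_coord (P x) hg hC (integrableOn_exp_neg 0) 0
  simp only [add_zero] at h
  exact h

/-- The Markov property at time `u`, applied to `laplace g`, whose mean under `P_y` is `resolvent P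
g y`. -/
theorem semigroup_resolvent (hP : IsMarkovFamily P) (hg : Measurable g) {C : ℝ}
    (hC : ∀ x, |g x| ≤ C) (u : ℝ≥0) (x : S) : semigroup P u (resolvent P g) x
      = ∫ s in Set.Ioi (0 : ℝ), Real.exp (-s) * semigroup P (s + u).toNNReal g x := by
  have h := hP.setIntegral_shift x u MeasurableSet.univ (measurable_laplace hg)
    (fun ω => abs_integral_exp_neg_mul_le fun s => hC (coord s.toNNReal ω))
  simp only [setIntegral_univ, integral_laplace hg hC, integral_laplace_shift hg hC] at h
  exact h.symm

/-- The resolvent equation `T_u R g - R g = ∫₀ᵘ T_r (R g - g) dr`. -/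
theorem semigroup_resolvent_sub (hP : IsMarkovFamily P) (hg : Continuous g) {C : ℝ}
    (hC : ∀ x, |g x| ≤ C) (u : ℝ≥0) (x : S) :
    semigroup P u (resolvent P g) x - resolvent P g x
      = ∫ r in (0 : ℝ)..u,
          (semigroup P r.toNNReal (resolvent P g) x - semigroup P r.toNNReal g x) := by
  have h := integral_exp_neg_mul_shift (continuousWithinAt_semigroup (P := P) x hg hC)
    (fun s => abs_semigroup_le hC _ x) u
  rw [semigroup_resolvent hP hg.measurable hC]
  refine h.trans (intervalIntegral.integral_congr fun r hr => ?_)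
  rw [Set.uIcc_of_le u.coe_nonneg] at hr
  simp only [semigroup_resolvent hP hg.measurable hC, Real.coe_toNNReal r hr.1]

theorem integral_semigroup_resolvent_sub (hP : IsMarkovFamily P) (hg : Continuous g) {C : ℝ}
    (hC : ∀ x, |g x| ≤ C) (hV : Measurable (resolvent P g)) (u : ℝ≥0) (x : S) :
    ∫ r in (0 : ℝ)..u, semigroup P r.toNNReal (fun y => resolvent P g y - g y) x
      = semigroup P u (resolvent P g) x - resolvent P g x := by
  rw [semigroup_resolvent_sub hP hg hC]
  congr 1
  ext r
  exact integral_sub (integrable_comp_coord (P x) hV (abs_resolvent_le hC) _)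
    (integrable_comp_coord (P x) hg.measurable hC _)

/-- The resolvent equation says that the process has mean zero under every `P_y`; the Markov
property upgrades this to a martingale. -/
theorem martingale_resolvent (hP : IsMarkovFamily P)
    (h0 : ∀ x, (P x).map (coord 0) = Measure.dirac x) (hg : Continuous g) {C : ℝ}
    (hC : ∀ x, |g x| ≤ C) (hV : Measurable (resolvent P g)) (x : S) :
    Martingale (compensated (resolvent P g) fun y => resolvent P g y - g y)
      (filtration S) (P x) := by
  have hR := abs_resolvent_le (P := P) hC
  have hb : ∀ y, |resolvent P g y - g y| ≤ C + C := fun y =>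
    (abs_sub _ _).trans (add_le_add (hR y) (hC y))
  refine hP.martingale_compensated hV hR (hV.sub hg.measurable) hb (fun y t => ?_) x
  rw [integral_compensated (P y) (h0 y) hV hR (hV.sub hg.measurable) hb]
  have h := integral_semigroup_resolvent_sub hP hg hC hV t y
  exact sub_eq_zero.2 h.symm

/-- The resolvent of a Feller–Dynkin family maps `C₀` into itself. -/
theorem IsFellerDynkin.exists_resolvent_eq (hP : IsFellerDynkin P) (g : C₀(S, ℝ)) :
    ∃ V : C₀(S, ℝ), ⇑V = resolvent P g := by
  choose T hT using fun t => hP.map_C0 t g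
  have hint := (integrableOn_exp_neg 0).mul_const ‖g‖
  have hmeas : ∀ x : S, AEStronglyMeasurable
      (fun s : ℝ => Real.exp (-s) * semigroup P s.toNNReal g x)
      (volume.restrict (Set.Ioi (0 : ℝ))) := fun x =>
    ((by fun_prop : Measurable fun s : ℝ => Real.exp (-s)).mul
      (measurable_of_continuousWithinAt_Ici (continuousWithinAt_semigroup (P := P) x
        (map_continuous g) (abs_apply_le_norm g)))).aestronglyMeasurable
  have hbound : ∀ x : S, ∀ᵐ s : ℝ ∂volume.restrict (Set.Ioi (0 : ℝ)),
      ‖Real.exp (-s) * semigroup P s.toNNReal g x‖ ≤ Real.exp (-s) * ‖g‖ := fun x =>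
    .of_forall fun s => by
      rw [norm_mul, Real.norm_of_nonneg (Real.exp_pos _).le]
      exact mul_le_mul_of_nonneg_left (abs_semigroup_le (abs_apply_le_norm g) _ x)
        (Real.exp_pos _).le
  refine ⟨⟨⟨resolvent P g, ?_⟩, ?_⟩, rfl⟩
  · refine continuous_of_dominated hmeas hbound hint (.of_forall fun s => ?_)
    rw [← hT]
    exact continuous_const.mul (map_continuous (T s.toNNReal))
  -- Dominated convergence along `cocompact S` needs a countably generated filter.
  · have := isCountablyGenerated_cocompact S
    have h := tendsto_integral_filter_of_dominated_convergence (l := cocompact S)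
      (f := fun _ => 0) (fun s : ℝ => Real.exp (-s) * ‖g‖) (.of_forall hmeas)
      (.of_forall hbound) hint (.of_forall fun s => ?_)
    · rw [integral_zero] at h
      exact h
    · rw [← hT]
      simpa using (zero_at_infty (T s.toNNReal)).const_mul (Real.exp (-s))

end Resolvent

/-! ### Extension by resolvents. -/

section Generator

variable {P : S → Measure (PathSpace S)}

/-- With `f` and `𝓛 f` bounded, the local martingale is bounded on `[0, u]`, hence has mean zero. -/
theorem InputData.IsSolution.semigroup_sub_eq [∀ x, IsProbabilityMeasure (P x)]
    {d : InputData S} {Γ : Set (PathSpace S)} {x : S}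
    (hP : d.IsSolution Γ (Measure.dirac x) (P x)) (f : d.D) {C C' : ℝ} (hC : ∀ x, |f.1 x| ≤ C)
    (hC' : ∀ x, |d.L f x| ≤ C') (u : ℝ≥0) :
    ∫ s in (0 : ℝ)..u, semigroup P s.toNNReal (d.L f) x = semigroup P u f.1 x - f.1 x := by
  have hz : ∫ ω, compensated f.1 (d.L f) u ω ∂P x = 0 := by
    refine IsLocalMartingale.integral_eq_zero (hP.isLocalMartingale f) (compensated_zero _ _) u
      (C := 2 * C + C' * u) fun s hs ω => (abs_compensated_le hC hC' s ω).trans ?_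
    have : 0 ≤ C' := (abs_nonneg _).trans (hC' x)
    gcongr
  rw [integral_compensated (P x) hP.initial_law f.1.continuous.measurable hC
    (d.measurable_L f) hC'] at hz
  simp only [semigroup]
  linarith

/-- Adding the resolvents of nonnegative functions in `C₀` to the test functions yields an extension
with a Lyapunov function for every compact set. -/
theorem IsFellerDynkin.exists_isExtension {d : InputData S} {Γ : Set (PathSpace S)}
    (hP : ∀ x : S, d.IsSolution Γ (Measure.dirac x) (P x))
    (hL : ∀ f : d.D, (∃ g : C₀(S, ℝ), ⇑g = ⇑f.1) → ∃ h : C₀(S, ℝ), ⇑h = d.L f)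
    (hFD : IsFellerDynkin P) :
    ∃ d' : InputData S, d'.IsExtension d Γ P ∧
      ∀ K : Set S, IsCompact K → ∃ V : d'.D, d'.IsLyapunov K V := by
  classical
  have hprob : ∀ x, IsProbabilityMeasure (P x) := fun x => (hP x).isProbabilityMeasure
  have hM := hFD.isCbFeller.isMarkov
  have h0 := fun x => (hP x).initial_law
  let R : Set C(S, ℝ) := {f | ∃ g : C₀(S, ℝ), (∀ x, 0 ≤ g x) ∧ ⇑f = resolvent P g}
  have hR : ∀ f : (d.D ∪ R : Set C(S, ℝ)), f.1 ∉ d.D → f.1 ∈ R := fun f hf => f.2.resolve_left hf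
  let d' : InputData S :=
    { D := d.D ∪ R
      -- On `D` the old operator takes precedence, as an extension requires. Elsewhere any `g ≥ 0`
      -- in `C₀` with `f = R g` will do, so uniqueness of `g` is not needed.
      L := fun f => if h : f.1 ∈ d.D then d.L ⟨f.1, h⟩ else fun x => f.1 x - (hR f h).choose x
      measurable_L := fun f => by
        split_ifs with h
        · exact d.measurable_L _
        · exact f.1.continuous.measurable.sub (map_continuous _).measurable
      integrable_L := fun f ω t => by
        split_ifs with h
        · exact d.integrable_L _ ω t
        · obtain ⟨-, hg⟩ := (hR f h).choose_spec
          refine intervalIntegrable_comp_coord (C := ‖(hR f h).choose‖ + ‖(hR f h).choose‖)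
            (h := fun y => f.1 y - (hR f h).choose y)
            (f.1.continuous.measurable.sub (map_continuous _).measurable)
            (fun x => (abs_sub _ _).trans (add_le_add ?_ (abs_apply_le_norm _ x))) ω 0 t
          exact (congrArg abs (congrFun hg x)).trans_le (abs_resolvent_le (abs_apply_le_norm _) x) }
  have hsub : d.D ⊆ d'.D := Set.subset_union_left
  have heq : ∀ f : d.D, d'.L ⟨f.1, hsub f.2⟩ = d.L f := fun f => dif_pos f.2
  refine ⟨d', ⟨hsub, heq, fun x => ⟨hprob x, (hP x).measure_eq_one, h0 x, fun f => ?_⟩⟩,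
    fun K hK => ?_⟩
  · by_cases h : f.1 ∈ d.D
    · have h1 := (hP x).isLocalMartingale ⟨f.1, h⟩
      have h2 : d'.L f = d.L ⟨f.1, h⟩ := dif_pos h
      unfold InputData.process at h1 ⊢
      rwa [h2]
    · have h2 : d'.L f = fun x => f.1 x - (hR f h).choose x := dif_neg h
      obtain ⟨-, hg⟩ := (hR f h).choose_spec
      have h3 := martingale_resolvent hM h0 (map_continuous (hR f h).choose)
        (abs_apply_le_norm _) (hg ▸ f.1.continuous.measurable) x
      refine Locally.of_prop ?_
      unfold InputData.process
      rw [h2]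
      rw [← hg] at h3
      exact h3
  · obtain ⟨k, hk1, -, hkc, hk01⟩ :=
      exists_continuous_one_zero_of_isCompact hK isClosed_empty (Set.disjoint_empty K)
    let g : C₀(S, ℝ) := ⟨k, hkc.is_zero_at_infty⟩
    have hg0 : ∀ x, 0 ≤ g x := fun x => (hk01 x).1
    obtain ⟨V, hV⟩ := hFD.exists_resolvent_eq g
    have hVR : (V : C(S, ℝ)) ∈ R := ⟨g, hg0, hV⟩
    refine ⟨⟨(V : C(S, ℝ)), Or.inr hVR⟩, fun x => ?_, ⟨V, rfl⟩, ?_, 1, one_pos, fun x => ?_⟩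
    · change 0 ≤ V x
      rw [hV]
      exact resolvent_nonneg hg0 x
    · rcases K.eq_empty_or_nonempty with rfl | hne
      · exact ⟨1, one_pos, fun x hx => hx.elim⟩
      · obtain ⟨y, hy, hmin⟩ := hK.exists_isMinOn hne (map_continuous V).continuousOn
        refine ⟨V y, ?_, fun x hx => hmin hx⟩
        rw [hV]
        refine resolvent_pos (map_continuous g) (abs_apply_le_norm g) hg0 (h0 y) ?_
        change 0 < k y
        simp [hk1 hy]
    · rw [one_mul]
      by_cases h : (V : C(S, ℝ)) ∈ d.D
      · have h2 : d'.L ⟨(V : C(S, ℝ)), Or.inr hVR⟩ = d.L ⟨(V : C(S, ℝ)), h⟩ := dif_pos h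
        obtain ⟨l, hl⟩ := hL ⟨(V : C(S, ℝ)), h⟩ ⟨V, rfl⟩
        -- Both sides are bounded and continuous, and the time integrals of their semigroups both
        -- equal `T_u V - V`: one by the martingale problem, the other by the resolvent equation.
        have h3 : l x = (V - g) x := by
          refine eq_of_integral_semigroup_eq (h0 x) (map_continuous l) (abs_apply_le_norm l)
            (map_continuous (V - g)) (abs_apply_le_norm (V - g)) fun u => ?_
          rw [hl, (hP x).semigroup_sub_eq ⟨(V : C(S, ℝ)), h⟩ (abs_apply_le_norm V)
            (hl ▸ abs_apply_le_norm l)]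
          have h4 := integral_semigroup_resolvent_sub hM (map_continuous g) (abs_apply_le_norm g)
            (hV ▸ (map_continuous V).measurable) u x
          rw [← hV] at h4
          exact h4.symm
        rw [h2, ← hl, h3]
        change V x - g x ≤ V x
        linarith [hg0 x]
      · have h2 : d'.L ⟨(V : C(S, ℝ)), Or.inr hVR⟩ =
            fun x => V x - (hR ⟨(V : C(S, ℝ)), Or.inr hVR⟩ h).choose x := dif_neg h
        rw [h2]
        change V x - _ ≤ V x
        linarith [(hR ⟨(V : C(S, ℝ)), Or.inr hVR⟩ h).choose_spec.1 x]

end Generator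

/-! ### Lyapunov functions imply the Feller-Dynkin property. -/

section Lyapunov

variable {P : S → Measure (PathSpace S)} [∀ x, IsProbabilityMeasure (P x)] {d : InputData S}
  {Γ : Set (PathSpace S)}

/-- The one-step estimate for a Lyapunov function, from Fatou's lemma along a localizing
sequence. -/
theorem InputData.IsSolution.semigroup_le_add_integral {x : S}
    (hP : d.IsSolution Γ (Measure.dirac x) (P x)) {V : d.D} (hV : ∀ y, 0 ≤ V.1 y) {C : ℝ}
    (hC : ∀ y, |V.1 y| ≤ C) {c : ℝ} (hc : 0 < c) (hle : ∀ y, d.L V y ≤ c * V.1 y) (t : ℝ≥0) :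
    semigroup P t V.1 x ≤ V.1 x + c * ∫ s in (0 : ℝ)..t, semigroup P s.toNNReal V.1 x := by
  have hVm : Measurable V.1 := V.1.continuous.measurable
  obtain ⟨σ, hσt, hσ, hint⟩ := IsLocalMartingale.exists_integral_eq_zero
    (hP.isLocalMartingale V) (compensated_zero _ _) t
  let I : ℝ≥0 → PathSpace S → ℝ := fun u ω => ∫ s in (0 : ℝ)..u, V.1 (coord s.toNNReal ω)
  -- `𝓛 V` is only bounded above, so dominated convergence for the local martingale `M` is not
  -- available. Instead `V(X_u) ≤ Y + M_u` for `u ≤ t`, so the variables `Y + M_{σ_n}` are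
  -- nonnegative with common mean `E Y`, and Fatou's lemma applies.
  let Y : PathSpace S → ℝ := fun ω => V.1 (coord 0 ω) + c * I t ω
  have hI : Integrable (I t) (P x) := by
    refine Integrable.of_bound (((measurable_integral_coord hVm t).mono ((filtration S).le t)
      le_rfl).aestronglyMeasurable) (C * |(t : ℝ) - 0|) (.of_forall fun ω => ?_)
    exact intervalIntegral.norm_integral_le_of_norm_le_const fun s _ => hC _
  have hY : Integrable Y (P x) := (integrable_comp_coord (P x) hVm hC 0).add (hI.const_mul c)
  have hYint : ∫ ω, Y ω ∂P x
      = V.1 x + c * ∫ s in (0 : ℝ)..t, semigroup P s.toNNReal V.1 x := by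
    have h1 : ∫ ω, V.1 (coord 0 ω) ∂P x = V.1 x := semigroup_zero hP.initial_law hVm
    have h2 := integral_intervalIntegral_coord (P x) hVm hC t
    simp only [Y]
    rw [integral_add (integrable_comp_coord (P x) hVm hC 0) (hI.const_mul c),
      integral_const_mul, h1, h2]
    rfl
  have hIi := intervalIntegrable_comp_coord hVm hC
  have hdom : ∀ u ≤ t, ∀ ω, V.1 (coord u ω) ≤ Y ω + d.process V u ω := by
    intro u hu ω
    have h1 : ∫ s in (0 : ℝ)..u, d.L V (coord s.toNNReal ω)
        ≤ ∫ s in (0 : ℝ)..u, c * V.1 (coord s.toNNReal ω) :=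
      intervalIntegral.integral_mono_on u.coe_nonneg (d.integrable_L V ω u)
        ((hIi ω 0 u).const_mul c) fun s _ => hle _
    rw [intervalIntegral.integral_const_mul] at h1
    have h2 : I u ω ≤ I t ω :=
      intervalIntegral.integral_mono_interval le_rfl u.coe_nonneg (NNReal.coe_le_coe.2 hu)
        (.of_forall fun s => hV _) (hIi ω 0 t)
    have h3 := mul_le_mul_of_nonneg_left h2 hc.le
    simp only [Y, InputData.process]
    linarith
  have hfatou := lintegral_liminf_le' (μ := P x) (u := atTop)
    (f := fun n ω => ENNReal.ofReal (Y ω + d.process V (σ n ω) ω))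
    fun n => (hY.add (hint n).1).aestronglyMeasurable.aemeasurable.ennreal_ofReal
  have hn : ∀ n, ∫⁻ ω, ENNReal.ofReal (Y ω + d.process V (σ n ω) ω) ∂P x
      = ENNReal.ofReal (∫ ω, Y ω ∂P x) := fun n => by
    have hYn : Integrable (fun ω => Y ω + d.process V (σ n ω) ω) (P x) := hY.add (hint n).1
    rw [← ofReal_integral_eq_lintegral_ofReal hYn
      (.of_forall fun ω => (hV _).trans (hdom _ (hσt n ω) ω)), integral_add hY (hint n).1,
      (hint n).2, add_zero]
  simp only [hn, liminf_const] at hfatou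
  have hlow : ENNReal.ofReal (semigroup P t V.1 x) ≤ ENNReal.ofReal (∫ ω, Y ω ∂P x) := by
    rw [semigroup, ofReal_integral_eq_lintegral_ofReal (integrable_comp_coord (P x) hVm hC t)
      (.of_forall fun ω => hV _)]
    refine (lintegral_mono_ae ?_).trans hfatou
    filter_upwards [hσ] with ω hω
    refine le_liminf_of_le (by isBoundedDefault) (hω.mono fun n hn => ?_)
    rw [hn]
    exact ENNReal.ofReal_le_ofReal (hdom t le_rfl ω)
  rw [← hYint]
  -- Dropping `ofReal` needs `Y ≥ 0`, which is `hdom` at time `0`, where `M_0 = 0`.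
  refine (ENNReal.ofReal_le_ofReal_iff (integral_nonneg fun ω => ?_)).1 hlow
  have h1 := hdom 0 zero_le ω
  have h2 : d.process V 0 ω = 0 := compensated_zero _ _ ω
  rw [h2, add_zero] at h1
  exact (hV _).trans h1

theorem InputData.IsSolution.semigroup_le_exp_mul {x : S}
    (hP : d.IsSolution Γ (Measure.dirac x) (P x)) {V : d.D} (hV : ∀ y, 0 ≤ V.1 y) {C : ℝ}
    (hC : ∀ y, |V.1 y| ≤ C) {c : ℝ} (hc : 0 < c) (hle : ∀ y, d.L V y ≤ c * V.1 y) (t : ℝ≥0) :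
    semigroup P t V.1 x ≤ V.1 x * Real.exp (c * t) := by
  have h := le_exp_mul_of_le_add_integral
    (continuousWithinAt_semigroup (P := P) x V.1.continuous hC)
    (fun s => abs_semigroup_le hC _ x) hc (fun s hs => by
      have := hP.semigroup_le_add_integral hV hC hc hle s.toNNReal
      rwa [Real.coe_toNNReal s hs] at this) t.coe_nonneg
  simpa using h

theorem isFellerDynkin_of_isLyapunov (hP : ∀ x, d.IsSolution Γ (Measure.dirac x) (P x))
    (hCb : IsCbFeller P) (hlyap : ∀ K : Set S, IsCompact K → ∃ V : d.D, d.IsLyapunov K V) :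
    IsFellerDynkin P := by
  refine ⟨hCb, fun t f => ?_⟩
  obtain ⟨g, hg⟩ := hCb.map_Cb t f.toBCF
  have hg' : ∀ x, g x = semigroup P t f x := fun x => congrFun hg x
  refine ⟨⟨g, ?_⟩, hg⟩
  rw [Metric.tendsto_nhds]
  intro ε hε
  have hK : ∃ K : Set S, IsCompact K ∧ ∀ y ∉ K, |f y| < ε / 2 := by
    have h1 := (Metric.tendsto_nhds.1 (zero_at_infty f)) (ε / 2) (by positivity)
    obtain ⟨K, hK, hsub⟩ := mem_cocompact.1 h1
    exact ⟨K, hK, fun y hy => by simpa using hsub hy⟩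
  obtain ⟨K, hK, hKf⟩ := hK
  obtain ⟨V, hVnn, ⟨v, hv⟩, ⟨m, hm, hmV⟩, c, hc, hle⟩ := hlyap K hK
  have hVC : ∀ y, |V.1 y| ≤ ‖v‖ := fun y => hv ▸ abs_apply_le_norm v y
  have hVm : Measurable V.1 := V.1.continuous.measurable
  -- On `K` one has `V ≥ m`, so `(‖f‖ / m) V ≥ ‖f‖`; off `K` the term `ε / 2` suffices.
  have hfV : ∀ y, |f y| ≤ ε / 2 + ‖f‖ / m * V.1 y := by
    intro y
    by_cases hy : y ∈ K
    · have h1 := hmV y hy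
      have h2 : ‖f‖ ≤ ‖f‖ / m * V.1 y := by
        rw [div_mul_eq_mul_div, le_div_iff₀ hm]
        gcongr
      linarith [abs_apply_le_norm f y]
    · have := hVnn y
      have h2 : 0 ≤ ‖f‖ / m * V.1 y := by positivity
      linarith [hKf y hy]
  have hbound : ∀ x, |g x| ≤ ε / 2 + ‖f‖ / m * (V.1 x * Real.exp (c * t)) := by
    intro x
    rw [hg']
    have hVi := integrable_comp_coord (P x) hVm hVC t
    calc |semigroup P t f x| ≤ ∫ ω, |f (coord t ω)| ∂P x := abs_integral_le_integral_abs
      _ ≤ ∫ ω, (ε / 2 + ‖f‖ / m * V.1 (coord t ω)) ∂P x :=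
        integral_mono (integrable_comp_coord (P x) (map_continuous f).measurable
          (abs_apply_le_norm f) t).abs ((integrable_const _).add (hVi.const_mul _))
          fun ω => hfV _
      _ = ε / 2 + ‖f‖ / m * semigroup P t V.1 x := by
        rw [integral_add (integrable_const _) (hVi.const_mul _), integral_const_mul]
        simp [semigroup]
      _ ≤ _ := by
        gcongr
        exact (hP x).semigroup_le_exp_mul hVnn hVC hc hle t
  have hlim : Tendsto (fun x => ε / 2 + ‖f‖ / m * (V.1 x * Real.exp (c * t))) (cocompact S)
      (𝓝 (ε / 2)) := by
    rw [← hv]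
    simpa using tendsto_const_nhds.add
      (((zero_at_infty v).mul_const (Real.exp (c * t))).const_mul (‖f‖ / m))
  filter_upwards [hlim.eventually (gt_mem_nhds (half_lt_self hε))] with x hx
  rw [dist_zero_right]
  exact (hbound x).trans_lt hx

end Lyapunov

end MartingaleProblem

theorem theorem3 {S : Type*} [TopologicalSpace S] [T2Space S] [LocallyCompactSpace S]
    [SecondCountableTopology S] [MeasurableSpace S] [BorelSpace S]
    (d : MartingaleProblem.InputData S)
    (Γ : Set (MartingaleProblem.PathSpace S)) (hΓ : MeasurableSet Γ)
    (P : S → Measure (MartingaleProblem.PathSpace S))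
    (hP : ∀ x : S, d.IsSolution Γ (Measure.dirac x) (P x))
    (hL : ∀ f : d.D, (∃ g : C₀(S, ℝ), ⇑g = ⇑f.1) → ∃ h : C₀(S, ℝ), ⇑h = d.L f)
    (hCb : MartingaleProblem.IsCbFeller P) :
    MartingaleProblem.IsFellerDynkin P ↔
      ∃ d' : MartingaleProblem.InputData S, d'.IsExtension d Γ P ∧
        ∀ K : Set S, IsCompact K → ∃ V : d'.D, d'.IsLyapunov K V := by
  have hprob : ∀ x, IsProbabilityMeasure (P x) := fun x => (hP x).isProbabilityMeasure
  exact ⟨MartingaleProblem.IsFellerDynkin.exists_isExtension hP hL, fun ⟨_, hext, hlyap⟩ =>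
    MartingaleProblem.isFellerDynkin_of_isLyapunov hext.isSolution hCb hlyap⟩
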